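/- Let $X$ be an AL-space, that is, a real Banach lattice (possibly $\{0\}$) whose norm satisfies $\|x+y\|=\|x\|+\|y\|$ for all $x,y\in X$ with $x,y\ge 0$. An $f$-algebra product on $X$ is an associative $\mathbb{R}$-bilinear map $P\colon X\times X\to X$ such that $P(x,y)\ge 0$ whenever $x,y\ge 0$, and such that $a\wedge b=0$ implies $P(c,a)\wedge b=0=P(a,c)\wedge b$ for every $c\ge 0$ in $X$. An atom of $X$ is an element $a\in X$ with $a\ge 0$ and $a\ne 0$ such that every $x\in X$ with $0\le x\le a$ is a scalar multiple of $a$. Then the zero product $P=0$ is the only $f$-algebra product on $X$ if and only if $X$ has no atoms. -/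

import Mathlib

/-- The norm of a normed lattice is additive on the positive cone. A Banach lattice with this
property is an AL-space. -/
class IsALNorm (X : Type*) [NormedAddCommGroup X] [Lattice X] : Prop where
  norm_add_of_nonneg : ∀ x y : X, 0 ≤ x → 0 ≤ y → ‖x + y‖ = ‖x‖ + ‖y‖

/-- An atom of a vector lattice: a nonzero positive element `a` such that every `x` with
`0 ≤ x ≤ a` is a scalar multiple of `a`. -/
def IsVectorLatticeAtom {X : Type*} [AddCommGroup X] [Lattice X] [Module ℝ X] (a : X) : Prop :=
  0 < a ∧ ∀ x : X, 0 ≤ x → x ≤ a → ∃ c : ℝ, x = c • a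

/-- A bilinear map `P` on a vector lattice is an f-algebra product: it is associative (so that it
is the product of a real algebra structure), products of positive elements are positive, and
`a ⊓ b = 0` implies `P c a ⊓ b = 0` and `P a c ⊓ b = 0` for every positive `c`. -/
structure IsFAlgebraProduct {X : Type*} [AddCommGroup X] [Lattice X] [Module ℝ X]
    (P : X →ₗ[ℝ] X →ₗ[ℝ] X) : Prop where
  assoc : ∀ x y z : X, P (P x y) z = P x (P y z)
  nonneg : ∀ x y : X, 0 ≤ x → 0 ≤ y → 0 ≤ P x y
  left_inf_eq_zero : ∀ a b c : X, a ⊓ b = 0 → 0 ≤ c → P c a ⊓ b = 0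
  right_inf_eq_zero : ∀ a b c : X, a ⊓ b = 0 → 0 ≤ c → P a c ⊓ b = 0

/-! An atom `a` splits the space into the line of `a` and the elements disjoint from `a`. With `φ`
the coordinate along `a`, `φ x * φ y • a` is a nonzero f-algebra product. Conversely, products of
disjoint elements vanish, so a component `p` of `e` has `P p e = P p p`, of norm at most `K * ‖p‖ ^
2`. If `P e e ≠ 0`, put `r = ‖P e e‖ / ‖e‖`. A nonzero component with `r * ‖p‖ ≤ ‖P p e‖` then has
norm at least `r / K`, so such components form a closed set away from `0`. Additivity of the norm
makes chains converge, and Zorn's lemma gives a minimal one. Without atoms it splits into two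
disjoint pieces, and since norms add, one piece inherits the inequality, a contradiction. Hence
squares of positive elements vanish, and polarization gives `P = 0`. -/

open Set Filter Topology

/-! ### Disjointness in vector lattices. -/

section Lattice

variable {X : Type*} [AddCommGroup X] [Lattice X]

/-- Being disjoint from `z` is inherited by smaller positive elements. -/
theorem inf_eq_zero_of_le {x y z : X} (hx : 0 ≤ x) (hxy : x ≤ y) (h : y ⊓ z = 0) :
    x ⊓ z = 0 :=
  le_antisymm (h ▸ inf_le_inf_right z hxy) (le_inf hx (h ▸ inf_le_right))

/-- The absolute value of a scalar multiple is dominated by the expected multiple. -/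
theorem abs_smul_le_abs_smul_abs [Module ℝ X] [IsOrderedModule ℝ X] (t : ℝ) (x : X) :
    |t • x| ≤ |t| • |x| := by
  have key : ∀ y : X, ∀ s : ℝ, 0 ≤ s → |s • y| ≤ s • |y| := fun y s hs =>
    abs_le'.2 ⟨smul_le_smul_of_nonneg_left (le_abs_self y) hs, by
      rw [← smul_neg]; exact smul_le_smul_of_nonneg_left (neg_le_abs y) hs⟩
  rcases le_total 0 t with ht | ht
  · rw [abs_of_nonneg ht]; exact key x t ht
  · rw [abs_of_nonpos ht]
    simpa [abs_neg] using key x (-t) (neg_nonneg.2 ht)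

variable [IsOrderedAddMonoid X]

/-- In a lattice ordered group, `z ⊓ ·` is subadditive on the positive cone. -/
theorem inf_add_le_inf_add_inf {x y z : X} (hx : 0 ≤ x) (hy : 0 ≤ y) (hz : 0 ≤ z) :
    z ⊓ (x + y) ≤ z ⊓ x + z ⊓ y := by
  rw [add_inf, inf_add, inf_add]
  refine le_inf (le_inf ?_ ?_) (le_inf ?_ ?_)
  · exact inf_le_left.trans (le_add_of_nonneg_left hz)
  · exact inf_le_left.trans (le_add_of_nonneg_left hx)
  · exact inf_le_left.trans (le_add_of_nonneg_right hy)
  · exact inf_le_right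

/-- Being disjoint from `z` is inherited by sums. -/
theorem add_inf_eq_zero {x y z : X} (hx : x ⊓ z = 0) (hy : y ⊓ z = 0) : (x + y) ⊓ z = 0 := by
  have hx0 : 0 ≤ x := hx ▸ inf_le_left
  have hy0 : 0 ≤ y := hy ▸ inf_le_left
  have hz0 : 0 ≤ z := hx ▸ inf_le_right
  refine le_antisymm ?_ (le_inf (add_nonneg hx0 hy0) hz0)
  have := inf_add_le_inf_add_inf hx0 hy0 hz0
  rwa [inf_comm z, inf_comm z, inf_comm z, hx, hy, add_zero] at this

theorem nsmul_inf_eq_zero {x z : X} (h : x ⊓ z = 0) (n : ℕ) : (n • x) ⊓ z = 0 := by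
  induction n with
  | zero => rw [zero_smul]; exact inf_eq_left.2 (h ▸ inf_le_right)
  | succ n ih => rw [succ_nsmul]; exact add_inf_eq_zero ih h

variable [Module ℝ X]

/-- The relation `|x - c • a| ⊓ a = 0` says that `c` is the coordinate of `x` along `a`; its
additivity, homogeneity and uniqueness make the coordinate a linear functional. -/
theorem abs_add_sub_smul_inf_eq_zero {a x y : X} {c d : ℝ} (hx : |x - c • a| ⊓ a = 0)
    (hy : |y - d • a| ⊓ a = 0) : |x + y - (c + d) • a| ⊓ a = 0 := by
  refine inf_eq_zero_of_le (abs_nonneg _) ?_ (add_inf_eq_zero hx hy)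
  rw [add_smul, add_sub_add_comm]
  exact abs_add_le _ _

variable [IsOrderedModule ℝ X]

theorem smul_inf_eq_zero {x z : X} (h : x ⊓ z = 0) {t : ℝ} (ht : 0 ≤ t) : (t • x) ⊓ z = 0 := by
  obtain ⟨n, hn⟩ := exists_nat_ge t
  have hx : 0 ≤ x := h ▸ inf_le_left
  refine inf_eq_zero_of_le (smul_nonneg ht hx) ?_ (nsmul_inf_eq_zero h n)
  rw [← Nat.cast_smul_eq_nsmul ℝ]
  exact smul_le_smul_of_nonneg_right hn hx

theorem abs_smul_sub_smul_inf_eq_zero {a x : X} {c : ℝ} (t : ℝ) (hx : |x - c • a| ⊓ a = 0) :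
    |t • x - (t * c) • a| ⊓ a = 0 := by
  refine inf_eq_zero_of_le (abs_nonneg _) ?_ (smul_inf_eq_zero hx (abs_nonneg t))
  rw [mul_smul, ← smul_sub]
  exact abs_smul_le_abs_smul_abs _ _

theorem eq_of_abs_sub_smul_inf_eq_zero {a x : X} (ha : 0 < a) {c d : ℝ}
    (hc : |x - c • a| ⊓ a = 0) (hd : |x - d • a| ⊓ a = 0) : c = d := by
  have h := abs_add_sub_smul_inf_eq_zero hc (abs_smul_sub_smul_inf_eq_zero (-1) hd)
  rw [neg_one_smul, add_neg_cancel, zero_sub, abs_neg, neg_one_mul, ← sub_eq_add_neg] at h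
  by_contra hne
  have hpos : 0 < |c - d| := abs_pos.2 (sub_ne_zero.2 hne)
  have h1 : |c - d| • a ≤ |(c - d) • a| := by
    rcases abs_cases (c - d) with ⟨h, _⟩ | ⟨h, _⟩ <;> rw [h]
    · exact le_abs_self _
    · rw [neg_smul]; exact neg_le_abs _
  have h2 := smul_inf_eq_zero (inf_eq_zero_of_le (smul_nonneg hpos.le ha.le) h1 h)
    (inv_nonneg.2 hpos.le)
  rw [inv_smul_smul₀ hpos.ne', inf_idem] at h2
  exact ha.ne' h2

end Lattice

/-! ### Atoms and their coordinate functionals. -/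

section NormedLattice

variable {X : Type*} [NormedAddCommGroup X] [Lattice X] [IsOrderedAddMonoid X]
  [HasSolidNorm X]

theorem norm_le_norm_of_nonneg_of_le {x y : X} (hx : 0 ≤ x) (h : x ≤ y) : ‖x‖ ≤ ‖y‖ :=
  norm_le_norm_of_abs_le_abs (by rwa [abs_of_nonneg hx, abs_of_nonneg (hx.trans h)])

variable [NormedSpace ℝ X] [IsOrderedModule ℝ X]

/-- Scalars `t` with `t • a ≤ x` have a largest element. -/
theorem exists_isGreatest_smul_le {a x : X} (ha : 0 < a) (hx : 0 ≤ x) :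
    ∃ c : ℝ, IsGreatest {t : ℝ | t • a ≤ x} c := by
  have hbdd : BddAbove {t : ℝ | t • a ≤ x} := by
    refine ⟨‖x‖ / ‖a‖, fun t ht => ?_⟩
    have hna : 0 < ‖a‖ := norm_pos_iff.2 ha.ne'
    rcases le_total t 0 with h0 | h0
    · exact h0.trans (by positivity)
    · rw [le_div_iff₀ hna]
      have := norm_le_norm_of_nonneg_of_le (smul_nonneg h0 ha.le) ht
      rwa [norm_smul, Real.norm_of_nonneg h0] at this
  have hcl : IsClosed {t : ℝ | t • a ≤ x} :=
    isClosed_le (by fun_prop) continuous_const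
  exact ⟨_, hcl.csSup_mem ⟨0, by simpa using hx⟩ hbdd, fun t ht => le_csSup hbdd ht⟩

/-- A normed lattice splits as the line of an atom and its disjoint complement. -/
theorem IsVectorLatticeAtom.exists_abs_sub_smul_inf_eq_zero {a : X} (ha : IsVectorLatticeAtom a)
    {x : X} (hx : 0 ≤ x) : ∃ c : ℝ, 0 ≤ c ∧ c • a ≤ x ∧ |x - c • a| ⊓ a = 0 := by
  obtain ⟨c, hc, hmax⟩ := exists_isGreatest_smul_le ha.1 hx
  have hc' : c • a ≤ x := hc
  have hy : 0 ≤ x - c • a := sub_nonneg.2 hc'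
  refine ⟨c, hmax (by simpa using hx), hc, ?_⟩
  rw [abs_of_nonneg hy]
  have h0 : 0 ≤ (x - c • a) ⊓ a := le_inf hy ha.1.le
  -- The meet is a multiple `t • a`; a positive `t` would contradict the maximality of `c`.
  obtain ⟨t, ht⟩ := ha.2 _ h0 inf_le_right
  have h1 : t • a ≤ x - c • a := ht ▸ inf_le_left
  have h2 : (c + t) • a ≤ x := by rw [add_smul]; exact le_sub_iff_add_le'.1 h1
  have h3 : t ≤ 0 := by linarith [hmax h2]
  exact le_antisymm (ht ▸ smul_nonpos_of_nonpos_of_nonneg h3 ha.1.le) h0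

/-- The coordinate functional of an atom. -/
theorem IsVectorLatticeAtom.exists_coordinate {a : X} (ha : IsVectorLatticeAtom a) :
    ∃ φ : X →ₗ[ℝ] ℝ, φ a = 1 ∧ ∀ x, 0 ≤ x → 0 ≤ φ x ∧ φ x • a ≤ x := by
  have hex : ∀ x : X, ∃ c : ℝ, |x - c • a| ⊓ a = 0 := fun x => by
    obtain ⟨c, -, -, hc⟩ := ha.exists_abs_sub_smul_inf_eq_zero (posPart_nonneg x)
    obtain ⟨d, -, -, hd⟩ := ha.exists_abs_sub_smul_inf_eq_zero (negPart_nonneg x)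
    refine ⟨c + -1 * d, ?_⟩
    have h := abs_add_sub_smul_inf_eq_zero hc (abs_smul_sub_smul_inf_eq_zero (-1) hd)
    rwa [neg_one_smul, ← sub_eq_add_neg, posPart_sub_negPart] at h
  choose f hf using hex
  have huniq : ∀ {x : X} {c : ℝ}, |x - c • a| ⊓ a = 0 → f x = c := fun h =>
    eq_of_abs_sub_smul_inf_eq_zero ha.1 (hf _) h
  refine ⟨{ toFun := f
            map_add' := fun x y => huniq (abs_add_sub_smul_inf_eq_zero (hf x) (hf y))
            map_smul' := fun t x => huniq (abs_smul_sub_smul_inf_eq_zero t (hf x)) }, ?_, ?_⟩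
  · exact huniq (by simpa using ha.1.le)
  · intro x hx
    obtain ⟨c, h0, hc, h⟩ := ha.exists_abs_sub_smul_inf_eq_zero hx
    change 0 ≤ f x ∧ f x • a ≤ x
    rw [huniq h]
    exact ⟨h0, hc⟩

/-- An atom gives rise to a nonzero f-algebra product. -/
theorem IsVectorLatticeAtom.exists_isFAlgebraProduct_ne_zero {a : X}
    (ha : IsVectorLatticeAtom a) :
    ∃ P : X →ₗ[ℝ] X →ₗ[ℝ] X, IsFAlgebraProduct P ∧ P ≠ 0 := by
  obtain ⟨φ, hφa, hφ⟩ := ha.exists_coordinate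
  have hdisj : ∀ u b c : X, u ⊓ b = 0 → 0 ≤ c → ((φ c * φ u) • a) ⊓ b = 0 := by
    intro u b c hub hc
    obtain ⟨h0, hle⟩ := hφ u (hub ▸ inf_le_left)
    rw [mul_smul]
    exact smul_inf_eq_zero (inf_eq_zero_of_le (smul_nonneg h0 ha.1.le) hle hub) (hφ c hc).1
  refine ⟨LinearMap.mk₂ ℝ (fun x y => (φ x * φ y) • a) ?_ ?_ ?_ ?_, ⟨?_, ?_, ?_, ?_⟩, ?_⟩
  · intro x y z; rw [map_add, add_mul, add_smul]
  · intro t x y; rw [map_smul, smul_eq_mul, mul_assoc, mul_smul]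
  · intro x y z; rw [map_add, mul_add, add_smul]
  · intro t x y; rw [map_smul, smul_eq_mul, mul_left_comm, mul_smul]
  · intro x y z
    simp only [LinearMap.mk₂_apply, map_smul, LinearMap.smul_apply, hφa, one_mul, smul_smul]
    congr 1
    ring
  · intro x y hx hy
    exact smul_nonneg (mul_nonneg (hφ x hx).1 (hφ y hy).1) ha.1.le
  · exact hdisj
  · intro u b c hub hc
    rw [LinearMap.mk₂_apply, mul_comm]
    exact hdisj u b c hub hc
  · intro h
    have h1 := LinearMap.congr_fun₂ h a a
    rw [LinearMap.mk₂_apply, hφa, mul_one, one_smul] at h1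
    exact ha.1.ne' h1

end NormedLattice

/-! ### Monotone limits, minimal elements and band projections in AL-spaces. -/

section ALSpace

variable {X : Type*} [NormedAddCommGroup X] [Lattice X] [IsOrderedAddMonoid X] [IsALNorm X]

theorem norm_sub_of_nonneg_of_le {x y : X} (hx : 0 ≤ x) (h : x ≤ y) :
    ‖y - x‖ = ‖y‖ - ‖x‖ := by
  have := IsALNorm.norm_add_of_nonneg (y - x) x (sub_nonneg.2 h) hx
  rw [sub_add_cancel] at this
  linarith

/-- A sequence of pairwise comparable positive elements of an AL-space converges as soon as the
norms converge. -/
theorem exists_tendsto_of_comparable [CompleteSpace X] {u : ℕ → X} (h0 : ∀ n, 0 ≤ u n)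
    (hu : ∀ m n, u m ≤ u n ∨ u n ≤ u m) {l : ℝ} (hl : Tendsto (fun n => ‖u n‖) atTop (𝓝 l)) :
    ∃ x, Tendsto u atTop (𝓝 x) := by
  refine cauchySeq_tendsto_of_complete ?_
  -- On comparable positive elements the norm is an isometry.
  have hd : ∀ m n, dist (u m) (u n) = dist ‖u m‖ ‖u n‖ := by
    intro m n
    rw [dist_eq_norm, Real.dist_eq]
    rcases hu m n with h | h
    · rw [norm_sub_rev, norm_sub_of_nonneg_of_le (h0 m) h, abs_sub_comm, abs_of_nonneg]
      rw [← norm_sub_of_nonneg_of_le (h0 m) h]; exact norm_nonneg _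
    · rw [norm_sub_of_nonneg_of_le (h0 n) h, abs_of_nonneg]
      rw [← norm_sub_of_nonneg_of_le (h0 n) h]; exact norm_nonneg _
  refine Metric.cauchySeq_iff.2 fun ε hε => ?_
  obtain ⟨N, hN⟩ := Metric.cauchySeq_iff.1 hl.cauchySeq ε hε
  exact ⟨N, fun m hm n hn => (hd m n).trans_lt (hN m hm n hn)⟩

variable [HasSolidNorm X] [CompleteSpace X]

/-- In an AL-space every chain in a closed set of positive elements has a lower bound in the
set. -/
theorem IsChain.exists_mem_lowerBound {S c : Set X} (hS : IsClosed S)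
    (hS0 : ∀ x ∈ S, 0 ≤ x)
    (hcS : c ⊆ S) (hc : IsChain (· ≤ ·) c) (hne : c.Nonempty) : ∃ x ∈ S, ∀ y ∈ c, x ≤ y := by
  have hbdd : BddBelow (norm '' c) := ⟨0, by rintro _ ⟨x, -, rfl⟩; exact norm_nonneg x⟩
  obtain ⟨v, -, hv, hvc⟩ := exists_seq_tendsto_sInf (hne.image norm) hbdd
  choose u huc huv using hvc
  have hnorm : Tendsto (fun n => ‖u n‖) atTop (𝓝 (sInf (norm '' c))) := by simpa only [huv] using hv
  obtain ⟨x, hx⟩ := exists_tendsto_of_comparable (fun n => hS0 _ (hcS (huc n)))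
    (fun m n => hc.total (huc m) (huc n)) hnorm
  refine ⟨x, hS.mem_of_tendsto hx (.of_forall fun n => hcS (huc n)), fun y hy => ?_⟩
  have hy0 := hS0 y (hcS hy)
  have hlim : Tendsto (fun n => (u n - y)⁺) atTop (𝓝 (x - y)⁺) :=
    (continuous_posPart.tendsto _).comp (hx.sub_const y)
  -- By comparability `(u n - y)⁺` is `0` or `u n - y`, and `‖y‖` is at least the infimum of the
  -- norms.
  have hzero : Tendsto (fun n => (u n - y)⁺) atTop (𝓝 0) := by
    refine squeeze_zero_norm (a := fun n => ‖u n‖ - sInf (norm '' c)) (fun n => ?_) ?_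
    · rcases hc.total (huc n) hy with h | h
      · rw [posPart_eq_zero.2 (sub_nonpos.2 h), norm_zero]
        exact sub_nonneg.2 (csInf_le hbdd ⟨_, huc n, rfl⟩)
      · rw [posPart_eq_self.2 (sub_nonneg.2 h), norm_sub_of_nonneg_of_le hy0 h]
        exact sub_le_sub_left (csInf_le hbdd ⟨_, hy, rfl⟩) _
    · simpa using hnorm.sub_const (sInf (norm '' c))
  exact sub_nonpos.1 (posPart_eq_zero.1 (tendsto_nhds_unique hlim hzero))

/-- In an AL-space every nonempty closed set of positive elements has a minimal element. -/
theorem IsClosed.exists_minimal_of_nonneg {S : Set X} (hS : IsClosed S)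
    (hS0 : ∀ x ∈ S, 0 ≤ x) (hne : S.Nonempty) : ∃ x, Minimal (· ∈ S) x := by
  obtain ⟨y, hy⟩ := hne
  obtain ⟨m, -, hm⟩ := @zorn_le_nonempty₀ Xᵒᵈ _ S (fun c hcS hc z hz =>
    IsChain.exists_mem_lowerBound (X := X) hS hS0 hcS hc.symm ⟨z, hz⟩) y hy
  exact ⟨m, hm⟩

/-- Band projections: every positive `p` splits into a part on which `u` is supported and a part
disjoint from `u`. -/
theorem exists_component_inf_eq_zero {u p : X} (hu : 0 ≤ u) (hp : 0 ≤ p) :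
    ∃ q, u ⊓ p ≤ q ∧ q ≤ p ∧ q ⊓ (p - q) = 0 ∧ u ⊓ (p - q) = 0 ∧
      ∀ v, u ⊓ v = 0 → q ⊓ v = 0 := by
  set w : ℕ → X := fun n => (n • u) ⊓ p with hw
  have hmono : Monotone w := fun m n h => inf_le_inf_right p (nsmul_le_nsmul_left hu h)
  have hw0 : ∀ n, 0 ≤ w n := fun n => le_inf (nsmul_nonneg hu n) hp
  have hnorm : Monotone fun n => ‖w n‖ := fun m n h =>
    norm_le_norm_of_nonneg_of_le (hw0 m) (hmono h)
  have hbdd : BddAbove (range fun n => ‖w n‖) := ⟨‖p‖, by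
    rintro _ ⟨n, rfl⟩; exact norm_le_norm_of_nonneg_of_le (hw0 n) inf_le_right⟩
  obtain ⟨q, hq⟩ := exists_tendsto_of_comparable hw0
    (fun m n => (le_total m n).imp (@hmono m n) (@hmono n m)) (tendsto_atTop_ciSup hnorm hbdd)
  have hwq : ∀ n, w n ≤ q := fun n => hmono.ge_of_tendsto hq n
  have hqp : q ≤ p := le_of_tendsto' hq fun n => inf_le_right
  have hdisj : ∀ v, u ⊓ v = 0 → q ⊓ v = 0 := fun v hv =>
    tendsto_nhds_unique (hq.inf_nhds tendsto_const_nhds) <|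
      tendsto_const_nhds.congr fun n => (inf_eq_zero_of_le (hw0 n) inf_le_left
        (nsmul_inf_eq_zero hv n)).symm
  have hupq : u ⊓ (p - q) = 0 := by
    refine le_antisymm ?_ (le_inf hu (sub_nonneg.2 hqp))
    -- Adding `u ⊓ (p - q)` to `w n` stays below `w (n + 1)`, so the limit `q` absorbs it.
    have h : u ⊓ (p - q) + q ≤ q := by
      refine le_of_tendsto' (hq.const_add _) fun n => ?_
      refine (le_inf ?_ ?_ : _ ≤ w (n + 1)).trans (hwq _)
      · rw [succ_nsmul']; exact add_le_add inf_le_left inf_le_left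
      · calc u ⊓ (p - q) + w n ≤ (p - q) + q := add_le_add inf_le_right (hwq n)
          _ = p := sub_add_cancel p q
    simpa using h
  exact ⟨q, by simpa [hw] using hwq 1, hqp, hdisj _ hupq, hupq, hdisj⟩

end ALSpace

/-! ### Splitting non-atoms; boundedness of positive bilinear maps. -/

section ALSpace

variable {X : Type*} [NormedAddCommGroup X] [Lattice X] [IsOrderedAddMonoid X]
  [NormedSpace ℝ X] [IsOrderedModule ℝ X] [HasSolidNorm X]

/-- A positive element that is not an atom dominates two nonzero disjoint positive elements. -/
theorem exists_nonzero_inf_eq_zero_of_not_atom {p : X} (hp : 0 < p)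
    (hat : ¬ IsVectorLatticeAtom p) : ∃ (u v : X) (t : ℝ), 0 < u ∧ u ≤ p ∧ 0 < v ∧ 0 ≤ t ∧
      v ≤ t • p ∧ u ⊓ v = 0 := by
  obtain ⟨x, hx0, hxp, hx⟩ : ∃ x, 0 ≤ x ∧ x ≤ p ∧ ∀ c : ℝ, x ≠ c • p := by
    simpa only [IsVectorLatticeAtom, hp, true_and, not_forall, not_exists, exists_prop] using hat
  obtain ⟨c, hc, hmax⟩ := exists_isGreatest_smul_le hp hx0
  have hc0 : 0 ≤ c := hmax (by simpa using hx0)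
  -- Otherwise `t ↓ c` gives `x = c • p`. For this `t`, both parts of `x - t • p` are nonzero.
  obtain ⟨t, htc, ht⟩ : ∃ t, c < t ∧ ¬ x ≤ t • p := by
    by_contra! h
    refine hx c (le_antisymm ?_ hc)
    have hlim : Tendsto (fun t : ℝ => t • p) (𝓝[>] c) (𝓝 (c • p)) :=
      ((continuous_id.smul continuous_const).tendsto c).mono_left nhdsWithin_le_nhds
    exact ge_of_tendsto hlim (eventually_nhdsWithin_of_forall h)
  have ht0 : 0 ≤ t := hc0.trans htc.le
  have htp : 0 ≤ t • p := smul_nonneg ht0 hp.le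
  refine ⟨(x - t • p)⁺, (x - t • p)⁻, t, ?_, ?_, ?_, ht0, ?_, posPart_inf_negPart_eq_zero _⟩
  · exact (posPart_nonneg _).lt_of_ne' fun h => ht (sub_nonpos.1 (posPart_eq_zero.1 h))
  · exact sup_le ((sub_le_self _ htp).trans hxp) hp.le
  · refine (negPart_nonneg _).lt_of_ne' fun h => htc.not_ge (hmax ?_)
    exact sub_nonneg.1 (negPart_eq_zero.1 h)
  · refine sup_le ?_ htp
    rw [neg_sub]; exact sub_le_self _ hx0

variable [CompleteSpace X]

/-- In an AL-space, a positive element that is not an atom is the sum of two nonzero disjoint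
positive elements. -/
theorem exists_component_of_not_atom [IsALNorm X] {p : X} (hp : 0 < p)
    (hat : ¬ IsVectorLatticeAtom p) : ∃ q, 0 < q ∧ q < p ∧ q ⊓ (p - q) = 0 := by
  obtain ⟨u, v, t, hu, hup, hv, ht, hvp, huv⟩ := exists_nonzero_inf_eq_zero_of_not_atom hp hat
  obtain ⟨q, huq, hqp, hq, -, hqv⟩ := exists_component_inf_eq_zero hu.le hp.le
  rw [inf_eq_left.2 hup] at huq
  refine ⟨q, hu.trans_le huq, hqp.lt_of_ne fun h => ?_, hq⟩
  -- If `q = p`, then `v ≤ t • p` is disjoint from itself.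
  subst h
  have := smul_inf_eq_zero (hqv v huv) ht
  rw [inf_eq_right.2 hvp] at this
  exact hv.ne' this

/-- Positive bilinear maps on a Banach lattice are bounded. -/
theorem exists_norm_apply_le_of_nonneg {P : X →ₗ[ℝ] X →ₗ[ℝ] X}
    (hP : ∀ x y : X, 0 ≤ x → 0 ≤ y → 0 ≤ P x y) : ∃ K : ℝ, 0 < K ∧ ∀ x y, 0 ≤ x → 0 ≤ y →
      ‖P x y‖ ≤ K * (‖x‖ * ‖y‖) := by
  have hmono : ∀ {x x' y y' : X}, 0 ≤ x → x ≤ x' → 0 ≤ y → y ≤ y' → P x y ≤ P x' y' := by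
    intro x x' y y' hx hxx hy hyy
    have h1 := hP (x' - x) y' (sub_nonneg.2 hxx) (hy.trans hyy)
    have h2 := hP x (y' - y) hx (sub_nonneg.2 hyy)
    rw [map_sub, LinearMap.sub_apply, sub_nonneg] at h1
    rw [map_sub, sub_nonneg] at h2
    exact h2.trans h1
  suffices h : ∃ K : ℝ, 0 < K ∧ ∀ x y, 0 ≤ x → 0 ≤ y → ‖x‖ = 1 → ‖y‖ = 1 → ‖P x y‖ ≤ K by
    obtain ⟨K, hK, h⟩ := h
    refine ⟨K, hK, fun x y hx hy => ?_⟩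
    rcases eq_or_ne x 0 with rfl | hx0
    · simp
    rcases eq_or_ne y 0 with rfl | hy0
    · simp
    have hnx := norm_pos_iff.2 hx0
    have hny := norm_pos_iff.2 hy0
    have hunit : ∀ {z : X}, 0 < ‖z‖ → ‖‖z‖⁻¹ • z‖ = 1 := fun {z} hz => by
      rw [norm_smul, norm_inv, norm_norm, inv_mul_cancel₀ hz.ne']
    have := h (‖x‖⁻¹ • x) (‖y‖⁻¹ • y) (smul_nonneg (by positivity) hx)
      (smul_nonneg (by positivity) hy) (hunit hnx) (hunit hny)
    rw [map_smul, map_smul, LinearMap.smul_apply, smul_smul, norm_smul, norm_mul, norm_inv,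
      norm_inv, norm_norm, norm_norm, ← mul_inv, inv_mul_le_iff₀ (by positivity)] at this
    linarith
  by_contra! h
  -- The factor `4 ^ n` offsets the weights `2⁻¹ ^ n` put on both arguments; `n + 1` then forces
  -- unboundedness.
  choose! x y hx hy hnx hny hxy using fun n : ℕ => h ((4 : ℝ) ^ n * (n + 1)) (by positivity)
  have hsum : ∀ z : ℕ → X, (∀ n, ‖z n‖ = 1) → Summable fun n => (2 : ℝ)⁻¹ ^ n • z n := by
    intro z hz
    refine Summable.of_norm ?_
    simp only [norm_smul, hz, mul_one, norm_pow, norm_inv, Real.norm_ofNat]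
    exact summable_geometric_of_lt_one (by norm_num) (by norm_num)
  have hle : ∀ z : ℕ → X, (∀ n, ‖z n‖ = 1) → (∀ n, 0 ≤ z n) → ∀ n,
      (2 : ℝ)⁻¹ ^ n • z n ≤ ∑' k, (2 : ℝ)⁻¹ ^ k • z k := fun z hz hz0 n =>
    (hsum z hz).le_tsum n fun k _ => smul_nonneg (by positivity) (hz0 k)
  obtain ⟨n, hn⟩ := exists_nat_gt
    ‖P (∑' k, (2 : ℝ)⁻¹ ^ k • x k) (∑' k, (2 : ℝ)⁻¹ ^ k • y k)‖
  have hpow : ∀ z : ℕ → X, (∀ n, 0 ≤ z n) → 0 ≤ (2 : ℝ)⁻¹ ^ n • z n := fun z hz =>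
    smul_nonneg (by positivity) (hz n)
  have h1 := norm_le_norm_of_nonneg_of_le (hP _ _ (hpow x hx) (hpow y hy))
    (hmono (hpow x hx) (hle x hnx hx n) (hpow y hy) (hle y hny hy n))
  rw [map_smul, map_smul, LinearMap.smul_apply, smul_smul, norm_smul, ← mul_pow,
    show (2 : ℝ)⁻¹ * 2⁻¹ = 4⁻¹ by norm_num, norm_pow, norm_inv, Real.norm_ofNat, inv_pow,
    inv_mul_le_iff₀ (by positivity)] at h1
  have h2 := (hxy n).trans_le h1
  have h3 := lt_of_mul_lt_mul_left h2 (by positivity)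
  linarith

end ALSpace

/-! ### Vanishing of f-algebra products without atoms. -/

section FAlgebraProduct

namespace IsFAlgebraProduct

theorem zero {X : Type*} [AddCommGroup X] [Lattice X] [Module ℝ X] :
    IsFAlgebraProduct (0 : X →ₗ[ℝ] X →ₗ[ℝ] X) where
  assoc _ _ _ := rfl
  nonneg _ _ _ _ := le_rfl
  left_inf_eq_zero _ b _ h _ := inf_eq_left.2 (show 0 ≤ b from h ▸ inf_le_right)
  right_inf_eq_zero _ b _ h _ := inf_eq_left.2 (show 0 ≤ b from h ▸ inf_le_right)

/-- An f-algebra product of disjoint elements vanishes. -/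
theorem apply_eq_zero_of_inf_eq_zero {X : Type*} [AddCommGroup X] [Lattice X] [Module ℝ X]
    {P : X →ₗ[ℝ] X →ₗ[ℝ] X} (hP : IsFAlgebraProduct P) {x y : X} (h : x ⊓ y = 0) :
    P x y = 0 := by
  have hx : 0 ≤ x := h ▸ inf_le_left
  have hy : 0 ≤ y := h ▸ inf_le_right
  -- Applying the axiom once on each side makes `P x y` disjoint from itself.
  have h1 : P x y ⊓ x = 0 := hP.left_inf_eq_zero y x x (by rwa [inf_comm]) hx
  have h2 : P x y ⊓ P x y = 0 := hP.right_inf_eq_zero x (P x y) y (by rwa [inf_comm]) hy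
  rwa [inf_idem] at h2

variable {X : Type*} [NormedAddCommGroup X] [Lattice X] [IsOrderedAddMonoid X]
  [NormedSpace ℝ X] [IsOrderedModule ℝ X] [HasSolidNorm X] [CompleteSpace X]

/-- Right multiplication by a positive element is continuous. -/
theorem continuous_apply_left {P : X →ₗ[ℝ] X →ₗ[ℝ] X} (hP : IsFAlgebraProduct P) {e : X}
    (he : 0 ≤ e) : Continuous fun x => P x e := by
  obtain ⟨K, hK, hbd⟩ := exists_norm_apply_le_of_nonneg hP.nonneg
  refine AddMonoidHomClass.continuous_of_bound (P.flip e) (2 * (K * ‖e‖)) fun x => ?_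
  have hx1 := hbd _ e (posPart_nonneg x) he
  have hx2 := hbd _ e (negPart_nonneg x) he
  have hp : ‖x⁺‖ ≤ ‖x‖ := by
    rw [← norm_abs_eq_norm x]
    exact norm_le_norm_of_nonneg_of_le (posPart_nonneg x) (sup_le (le_abs_self x) (abs_nonneg x))
  have hn : ‖x⁻‖ ≤ ‖x‖ := by
    rw [← norm_abs_eq_norm x]
    exact norm_le_norm_of_nonneg_of_le (negPart_nonneg x) (sup_le (neg_le_abs x) (abs_nonneg x))
  have hKe : 0 ≤ K * ‖e‖ := by positivity
  calc ‖P x e‖ = ‖P x⁺ e - P x⁻ e‖ := by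
        rw [← LinearMap.sub_apply, ← map_sub, posPart_sub_negPart]
    _ ≤ ‖P x⁺ e‖ + ‖P x⁻ e‖ := norm_sub_le _ _
    _ ≤ 2 * (K * ‖e‖) * ‖x‖ := by
        linarith [mul_le_mul_of_nonneg_left hp hKe, mul_le_mul_of_nonneg_left hn hKe]

variable [IsALNorm X] {P : X →ₗ[ℝ] X →ₗ[ℝ] X}

/-- On an AL-space without atoms, squares for an f-algebra product vanish. -/
theorem apply_self_eq_zero (hP : IsFAlgebraProduct P) (hX : ∀ a : X, ¬ IsVectorLatticeAtom a)
    {e : X} (he : 0 ≤ e) : P e e = 0 := by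
  obtain ⟨K, hK, hbd⟩ := exists_norm_apply_le_of_nonneg hP.nonneg
  by_contra hne
  have he0 : e ≠ 0 := by rintro rfl; simp at hne
  have hnP : 0 < ‖P e e‖ := norm_pos_iff.2 hne
  have hnorm : 0 < ‖e‖ := norm_pos_iff.2 he0
  set r : ℝ := ‖P e e‖ / ‖e‖ with hr
  have hr0 : 0 < r := by positivity
  -- A nonzero component of `e` whose product with `e` is large cannot have a small norm.
  have hlarge : ∀ p : X, 0 < p → p ⊓ (e - p) = 0 → r * ‖p‖ ≤ ‖P p e‖ → r / K ≤ ‖p‖ := by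
    intro p hp hpe hpr
    have h0 : P p e = P p p := by
      rw [← sub_eq_zero, ← map_sub]; exact hP.apply_eq_zero_of_inf_eq_zero hpe
    have h1 := hbd p p hp.le hp.le
    rw [← h0] at h1
    have hnp : 0 < ‖p‖ := norm_pos_iff.2 hp.ne'
    rw [div_le_iff₀ hK]
    refine le_of_mul_le_mul_right ?_ hnp
    linarith
  -- The last condition is automatic for nonzero `p` by `hlarge`; it excludes `0` while keeping `S`
  -- closed.
  set S : Set X := {p | 0 ≤ p ∧ p ⊓ (e - p) = 0 ∧ r * ‖p‖ ≤ ‖P p e‖ ∧ r / K ≤ ‖p‖} with hS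
  have hSclosed : IsClosed S :=
    isClosed_nonneg.inter <| (isClosed_eq (by fun_prop) continuous_const).inter <|
      (isClosed_le (by fun_prop) (hP.continuous_apply_left he).norm).inter
        (isClosed_le continuous_const continuous_norm)
  have heS : e ∈ S := by
    have h1 : e ⊓ (e - e) = 0 := by rw [sub_self]; exact inf_eq_right.2 he
    have h2 : r * ‖e‖ ≤ ‖P e e‖ := (div_mul_cancel₀ _ hnorm.ne').le
    exact ⟨he, h1, h2, hlarge e (he.lt_of_ne' he0) h1 h2⟩
  obtain ⟨p, ⟨hp0, hpe, hpr, hpK⟩, hmin⟩ :=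
    hSclosed.exists_minimal_of_nonneg (fun x hx => hx.1) ⟨e, heS⟩
  have hp : 0 < p := hp0.lt_of_ne' (norm_pos_iff.1 ((by positivity : 0 < r / K).trans_le hpK))
  have hsmall : ∀ q, 0 < q → q < p → q ⊓ (p - q) = 0 → ‖P q e‖ < r * ‖q‖ := by
    intro q hq hqp hqd
    by_contra! hqr
    -- Here `e - q` is the sum of `e - p` and `p - q`, both disjoint from `q`.
    have hqe : q ⊓ (e - q) = 0 := by
      have h := add_inf_eq_zero (z := q) (x := p - q) (y := e - p) (by rwa [inf_comm])
        (by rw [inf_comm]; exact inf_eq_zero_of_le hq.le hqp.le hpe)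
      rwa [add_comm, sub_add_sub_cancel, inf_comm] at h
    exact hqp.not_ge (hmin ⟨hq.le, hqe, hqr, hlarge q hq hqe hqr⟩ hqp.le)
  obtain ⟨q, hq, hqp, hqd⟩ := exists_component_of_not_atom hp (hX p)
  have h1 := hsmall q hq hqp hqd
  have h2 := hsmall (p - q) (sub_pos.2 hqp) (sub_lt_self p hq)
    (by rwa [sub_sub_cancel, inf_comm])
  have h3 : ‖P p e‖ ≤ ‖P q e‖ + ‖P (p - q) e‖ := by
    refine le_trans (le_of_eq ?_) (norm_add_le _ _)
    rw [← LinearMap.add_apply, ← map_add, add_sub_cancel]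
  rw [norm_sub_of_nonneg_of_le hq.le hqp.le] at h2
  linarith

/-- An AL-space without atoms has no nonzero f-algebra product. -/
theorem eq_zero_of_forall_not_atom (hP : IsFAlgebraProduct P)
    (hX : ∀ a : X, ¬ IsVectorLatticeAtom a) : P = 0 := by
  have hpos : ∀ x y : X, 0 ≤ x → 0 ≤ y → P x y = 0 := by
    intro x y hx hy
    -- Polarization: the positive elements `P x y` and `P y x` sum to zero.
    have h := hP.apply_self_eq_zero hX (add_nonneg hx hy)
    rw [map_add P, LinearMap.add_apply, map_add, map_add, hP.apply_self_eq_zero hX hx,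
      hP.apply_self_eq_zero hX hy, zero_add, add_zero] at h
    exact ((add_eq_zero_iff_of_nonneg (hP.nonneg x y hx hy) (hP.nonneg y x hy hx)).1 h).1
  refine LinearMap.ext₂ fun x y => ?_
  rw [← posPart_sub_negPart x, ← posPart_sub_negPart y]
  simp [hpos, posPart_nonneg, negPart_nonneg, -posPart_sub_negPart]

end IsFAlgebraProduct

end FAlgebraProduct

theorem corollary5p3 (X : Type*) [NormedAddCommGroup X] [Lattice X] [IsOrderedAddMonoid X]
    [NormedSpace ℝ X] [IsOrderedModule ℝ X] [HasSolidNorm X] [CompleteSpace X] [IsALNorm X] :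
    (∀ P : X →ₗ[ℝ] X →ₗ[ℝ] X, IsFAlgebraProduct P ↔ P = 0) ↔
      ¬ ∃ a : X, IsVectorLatticeAtom a := by
  constructor
  · rintro h ⟨a, ha⟩
    obtain ⟨P, hP, hne⟩ := ha.exists_isFAlgebraProduct_ne_zero
    exact hne ((h P).1 hP)
  · intro h P
    refine ⟨fun hP => hP.eq_zero_of_forall_not_atom fun a ha => h ⟨a, ha⟩, ?_⟩
    rintro rfl
    exact .zero
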